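/- Let $1\le p<\infty$ and $-1<\alpha<\infty$, let $\mathbb D$ be the open unit disk of $\mathbb C$, and let $A^p_\alpha$ be the weighted Bergman space of all analytic functions $f$ on $\mathbb D$ with $$\|f\|_{A^p_\alpha}=\Big(\int_{\mathbb D}|f(z)|^p(\alpha+1)(1-|z|^2)^\alpha\,dA(z)\Big)^{1/p}<\infty,\qquad dA=\tfrac1\pi\,dx\,dy.$$ Let $H^\infty$ be the space of bounded analytic functions on $\mathbb D$, and let $M_z$ be the bounded operator $(M_zf)(z)=zf(z)$ on $A^p_\alpha$. For a bounded linear operator $A$ on a Banach space $X$, a bounded linear operator $T$ on $X$ is called an abelian intertwiner of $A$ if there is a bounded linear operator $B$ on $X$ with $AB=BA$ and $TA=BT$. (1) If $m\in H^\infty$ and $\varphi:\mathbb D\to\mathbb D$ is analytic, then $(M_mC_\varphi f)(z)=m(z)f(\varphi(z))$ defines a bounded linear operator $M_mC_\varphi$ on $A^p_\alpha$, and it is an abelian intertwiner of $M_z$. (2) Conversely, if a bounded linear operator $T$ on $A^p_\alpha$ is an abelian intertwiner of $M_z$ and $T1\in H^\infty$, then there are $m\in H^\infty$ and an analytic map $\varphi:\mathbb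 D\to\mathbb D$ such that $T=M_mC_\varphi$, that is, $(Tf)(z)=m(z)f(\varphi(z))$ for all $f\in A^p_\alpha$ and $z\in\mathbb D$. -/

import Mathlib

open MeasureTheory
open scoped ENNReal

noncomputable section

/-- The open unit disk of the complex plane. -/
def unitDisk : Set ℂ := Metric.ball 0 1

/-- The measure `(α + 1) (1 - |z|²) ^ α dA(z)` on the unit disk, where `dA = π⁻¹ dx dy`. It is
written as a measure on `ℂ` that is carried by the disk. -/
def weightedArea (α : ℝ) : Measure ℂ :=
  (volume.restrict unitDisk).withDensity
    fun z => ENNReal.ofReal (Real.pi⁻¹ * ((α + 1) * (1 - ‖z‖ ^ 2) ^ α))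

/-- `m` is analytic on the unit disk (values outside the disk are irrelevant). -/
def IsAnalyticOnDisk (m : ℂ → ℂ) : Prop := DifferentiableOn ℂ m unitDisk

/-- `m ∈ H^∞`: `m` is a bounded analytic function on the unit disk (values outside the disk are
irrelevant). -/
def IsHInfty (m : ℂ → ℂ) : Prop :=
  IsAnalyticOnDisk m ∧ ∃ C : ℝ, ∀ z ∈ unitDisk, ‖m z‖ ≤ C

/-- `φ` is an analytic self-map of the unit disk (values outside the disk are irrelevant). -/
def IsAnalyticSelfMap (φ : ℂ → ℂ) : Prop :=
  IsAnalyticOnDisk φ ∧ Set.MapsTo φ unitDisk unitDisk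

/-- The analytic functions on the disk that are `p`-integrable for the weighted area measure. A
function on the disk is represented by its extension by zero to `ℂ`, which makes the
representation unique. -/
def bergmanSubmodule (p : ℝ≥0∞) (α : ℝ) : Submodule ℂ (ℂ → ℂ) where
  carrier := {f | IsAnalyticOnDisk f ∧ (∀ z, z ∉ unitDisk → f z = 0) ∧
    MemLp f p (weightedArea α)}
  add_mem' := fun {f g} hf hg =>
    ⟨DifferentiableOn.add hf.1 hg.1, fun z hz => by simp [hf.2.1 z hz, hg.2.1 z hz],
      hf.2.2.add hg.2.2⟩
  zero_mem' := ⟨differentiableOn_const (0 : ℂ), fun _ _ => rfl, MemLp.zero⟩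
  smul_mem' := fun c f hf =>
    ⟨DifferentiableOn.const_smul hf.1 c, fun z hz => by simp [hf.2.1 z hz],
      hf.2.2.const_smul c⟩

/-- The weighted Bergman space `A^p_α`. It is a type of its own, so that its only topology is the
one of its norm (and not that of pointwise convergence). -/
def Bergman (p : ℝ≥0∞) (α : ℝ) : Type := bergmanSubmodule p α

namespace Bergman

variable {p : ℝ≥0∞} {α : ℝ}

instance : AddCommGroup (Bergman p α) := inferInstanceAs (AddCommGroup (bergmanSubmodule p α))

instance : Module ℂ (Bergman p α) := inferInstanceAs (Module ℂ (bergmanSubmodule p α))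

instance : CoeFun (Bergman p α) (fun _ => ℂ → ℂ) := ⟨fun f => f.1⟩

theorem memLp (f : Bergman p α) : MemLp f p (weightedArea α) := f.2.2.2

theorem ext {f g : Bergman p α} (h : ∀ z ∈ unitDisk, f z = g z) : f = g := by
  apply Subtype.ext
  funext z
  by_cases hz : z ∈ unitDisk
  · exact h z hz
  · rw [f.2.2.1 z hz, g.2.2.1 z hz]

/-- The class in `L^p` of an element of the Bergman space. -/
def toLp (p : ℝ≥0∞) (α : ℝ) : Bergman p α →ₗ[ℂ] Lp ℂ p (weightedArea α) where
  toFun f := f.memLp.toLp f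
  map_add' _ _ := rfl
  map_smul' _ _ := rfl

theorem ae_weightedArea (α : ℝ) : ∀ᵐ z ∂(weightedArea α), z ∈ unitDisk :=
  (withDensity_absolutelyContinuous _ _).ae_le
    (ae_restrict_mem Metric.isOpen_ball.measurableSet)

theorem density_measurable (α : ℝ) : Measurable fun z : ℂ =>
    ENNReal.ofReal (Real.pi⁻¹ * ((α + 1) * (1 - ‖z‖ ^ 2) ^ α)) := by
  fun_prop

theorem toLp_injective (p : ℝ≥0∞) (α : ℝ) (hα : -1 < α) :
    Function.Injective (toLp p α) := by
  intro f g hfg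
  have h : (f : ℂ → ℂ) =ᵐ[weightedArea α] g :=
    (MemLp.toLp_eq_toLp_iff f.memLp g.memLp).1 hfg
  have h2 : (f : ℂ → ℂ) =ᵐ[volume.restrict unitDisk] g := by
    have h3 := (ae_withDensity_iff (density_measurable α)).1 h
    filter_upwards [h3, ae_restrict_mem Metric.isOpen_ball.measurableSet] with z hz hzD
    apply hz
    have hz1 : ‖z‖ < 1 := by simpa [unitDisk] using hzD
    have : 0 < 1 - ‖z‖ ^ 2 := by nlinarith [norm_nonneg z]
    have h4 : 0 < α + 1 := by linarith
    have := Real.rpow_pos_of_pos this α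
    exact (ENNReal.ofReal_pos.2 (by positivity)).ne'
  have h5 : Set.EqOn f g unitDisk :=
    Measure.eqOn_open_of_ae_eq h2 Metric.isOpen_ball f.2.1.continuousOn g.2.1.continuousOn
  exact ext h5

/-- The norm of `A^p_α` is the `L^p` norm for the weighted area measure. -/
instance [Fact (1 ≤ p)] [hα : Fact (-1 < α)] : NormedAddCommGroup (Bergman p α) :=
  NormedAddCommGroup.induced _ (Lp ℂ p (weightedArea α)) (toLp p α)
    (toLp_injective p α hα.out)

instance [Fact (1 ≤ p)] [Fact (-1 < α)] : NormedSpace ℂ (Bergman p α) :=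
  NormedSpace.induced ℂ (Bergman p α) (Lp ℂ p (weightedArea α)) (toLp p α)

theorem norm_def [Fact (1 ≤ p)] [Fact (-1 < α)] (f : Bergman p α) :
    ‖f‖ = (eLpNorm f p (weightedArea α)).toReal :=
  Lp.norm_toLp f f.memLp

theorem lintegral_density_lt_top (α : ℝ) (hα : -1 < α) :
    ∫⁻ z in unitDisk, ENNReal.ofReal (Real.pi⁻¹ * ((α + 1) * (1 - ‖z‖ ^ 2) ^ α)) < ∞ := by
  have h0 : 0 < α + 1 := by linarith
  -- integrability of the radial profile
  have hprof : IntegrableOn (fun r : ℝ => (1 - r) ^ α) (Set.Ioo 0 1) := by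
    have h1 : IntervalIntegrable (fun r : ℝ => r ^ α) volume 0 1 :=
      intervalIntegral.intervalIntegrable_rpow' hα
    have h2 := (h1.comp_sub_left 1).symm
    simp only [sub_zero, sub_self] at h2
    rw [intervalIntegrable_iff_integrableOn_Ioo_of_le zero_le_one] at h2
    exact h2
  have hbound : ∀ r ∈ Set.Ioo (0 : ℝ) 1,
      (1 - r ^ 2) ^ α ≤ 2 ^ |α| * (1 - r) ^ α := by
    intro r hr
    have e : 1 - r ^ 2 = (1 + r) * (1 - r) := by ring
    rw [e, Real.mul_rpow (by linarith [hr.1]) (by linarith [hr.2])]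
    have : (1 + r) ^ α ≤ 2 ^ |α| :=
      (Real.rpow_le_rpow_of_exponent_le (by linarith [hr.1]) (le_abs_self α)).trans
        (Real.rpow_le_rpow (by linarith [hr.1]) (by linarith [hr.2]) (abs_nonneg α))
    exact mul_le_mul_of_nonneg_right this (Real.rpow_nonneg (by linarith [hr.2]) _)
  have hprof2 : IntegrableOn (fun r : ℝ => r ^ (Module.finrank ℝ ℂ - 1) •
      (Set.indicator (Set.Iio 1) (fun r : ℝ => (1 - r ^ 2) ^ α) r)) (Set.Ioi 0) := by
    have h3 : IntegrableOn (fun r : ℝ => r • ((1 - r ^ 2) ^ α : ℝ)) (Set.Ioo 0 1) := by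
      refine Integrable.mono' (hprof.const_mul (2 ^ |α|))
        (by apply Measurable.aestronglyMeasurable; fun_prop) ?_
      filter_upwards [ae_restrict_mem measurableSet_Ioo] with r hr
      have hp : 0 ≤ (1 - r ^ 2) ^ α := Real.rpow_nonneg (by nlinarith [hr.1, hr.2]) _
      rw [smul_eq_mul, Real.norm_of_nonneg (mul_nonneg hr.1.le hp)]
      exact (mul_le_of_le_one_left hp hr.2.le).trans (hbound r hr)
    rw [← integrable_indicator_iff measurableSet_Ioo] at h3
    rw [← integrable_indicator_iff measurableSet_Ioi]
    refine h3.congr (Filter.Eventually.of_forall fun r => ?_)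
    by_cases a : 0 < r <;> by_cases b : r < 1 <;>
      simp [Set.indicator, a, b, Complex.finrank_real_complex]
  have h4 : Integrable (fun z : ℂ =>
      Set.indicator (Set.Iio 1) (fun r : ℝ => (1 - r ^ 2) ^ α) ‖z‖) :=
    (integrable_fun_norm_addHaar volume).2 hprof2
  have h5 : IntegrableOn (fun z : ℂ => Real.pi⁻¹ * ((α + 1) * (1 - ‖z‖ ^ 2) ^ α)) unitDisk := by
    refine Integrable.const_mul (Integrable.const_mul ?_ _) _
    refine (h4.integrableOn (s := unitDisk)).congr ?_
    filter_upwards [ae_restrict_mem Metric.isOpen_ball.measurableSet] with z hz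
    have hz1 : ‖z‖ < 1 := by simpa [unitDisk] using hz
    simp [Set.indicator, hz1]
  refine lt_of_le_of_lt (lintegral_mono fun z => ?_) h5.2
  exact Real.ofReal_le_enorm _

theorem isFiniteMeasure_weightedArea (α : ℝ) (hα : -1 < α) :
    IsFiniteMeasure (weightedArea α) :=
  isFiniteMeasure_withDensity (lintegral_density_lt_top α hα).ne

/-- The constant function `1`, as an element of `A^p_α`. -/
def one (p : ℝ≥0∞) (α : ℝ) [hα : Fact (-1 < α)] : Bergman p α :=
  ⟨unitDisk.indicator fun _ => 1,
    (differentiableOn_const (1 : ℂ)).congr fun z hz => by simp [hz],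
    fun z hz => by simp [hz],
    haveI := isFiniteMeasure_weightedArea α hα.out
    (memLp_const (1 : ℂ)).indicator Metric.isOpen_ball.measurableSet⟩

theorem mulZ_ae_le (f : Bergman p α) :
    ∀ᵐ z ∂(weightedArea α), ‖z * f z‖ ≤ ‖f z‖ := by
  filter_upwards [ae_weightedArea α] with z hz
  have hz1 : ‖z‖ < 1 := by simpa [unitDisk] using hz
  rw [norm_mul]
  exact mul_le_of_le_one_left (norm_nonneg _) hz1.le

/-- The linear map `f ↦ z f` on `A^p_α`. -/
def mulZLinear (p : ℝ≥0∞) (α : ℝ) : Bergman p α →ₗ[ℂ] Bergman p α where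
  toFun f := ⟨fun z => z * f z, DifferentiableOn.mul differentiableOn_id f.2.1,
    fun z hz => by simp [f.2.2.1 z hz],
    f.memLp.mono (measurable_id.aestronglyMeasurable.mul f.memLp.1) (mulZ_ae_le f)⟩
  map_add' f g := Subtype.ext (funext fun z => mul_add z (f z) (g z))
  map_smul' c f := Subtype.ext (funext fun z => mul_left_comm z c (f z))

/-- The multiplication operator `M_z`, `f ↦ z f`, as a bounded operator on `A^p_α`. -/
def mulZ (p : ℝ≥0∞) (α : ℝ) [Fact (1 ≤ p)] [Fact (-1 < α)] :
    Bergman p α →L[ℂ] Bergman p α :=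
  (mulZLinear p α).mkContinuous 1 fun f => by
    rw [one_mul, norm_def, norm_def]
    exact ENNReal.toReal_mono f.memLp.eLpNorm_ne_top (eLpNorm_mono_ae (mulZ_ae_le f))

/-- `T = M_m C_φ` on `A^p_α`: `(T f)(z) = m(z) f(φ(z))` for all `f ∈ A^p_α` and `z` in the disk. -/
def IsWeightedComposition [Fact (1 ≤ p)] [Fact (-1 < α)]
    (T : Bergman p α →L[ℂ] Bergman p α) (m φ : ℂ → ℂ) : Prop :=
  ∀ f : Bergman p α, ∀ z ∈ unitDisk, T f z = m z * f (φ z)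

end Bergman

/-- The commutant algebra `A'` of a bounded operator `A`. -/
def commutantAlgebra {X : Type*} [NormedAddCommGroup X] [NormedSpace ℂ X] (A : X →L[ℂ] X) :
    Set (X →L[ℂ] X) :=
  {R | A ∘L R = R ∘L A}

/-- `T` is an abelian intertwiner of `A`: there is `B ∈ A'` with `T A = B T`. -/
def IsAbelianIntertwiner {X : Type*} [NormedAddCommGroup X] [NormedSpace ℂ X]
    (A T : X →L[ℂ] X) : Prop :=
  ∃ B ∈ commutantAlgebra A, T ∘L A = B ∘L T

end

/-! For (1), boundedness of `C_φ` is Littlewood subordination. The Poisson integral and Jensen's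
inequality bound the mean of `|f ∘ φ|^q` over the circle of radius `r` by a constant times the mean
of `|f|^q` over a circle of radius `R` for which `φ` maps the closed `r`-disk into the open
`R`-disk. By Schwarz–Pick, `R = 1 - c(1 - r)` works with `c` depending only on `φ 0`, and this
affine substitution changes the radial weight by a bounded factor
(`lintegral_comp_weightedArea_le`). The intertwining relation then holds with `B = M_φ`.

For (2), dividing `f - f(w)` by `z - w` inside the space shows that `B` is multiplication by `b =
B1` (`commutant_apply`). Hence `f ↦ (T f)(w)` turns `M_z` into the scalar `b(w)`. If `b(w)` lies in
the disk, the same division gives `(T f)(w) = (T1)(w) f(b(w))`. If `|b(w)| ≥ 1`, then `(T f)(w) =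
0`, because the powers of `M_z` tend strongly to zero; the maximum principle and the identity
theorem spread this to `T = 0`. So either `b` is a self-map of the disk and `m = T1`, `φ = b`, or `T
= 0`. -/

/-! ### Poisson integrals on circles -/

/-- The normalized Lebesgue measure on the interval `(-π, π)` of angles. -/
noncomputable def angleMeasure : Measure ℝ :=
  ENNReal.ofReal (2 * Real.pi)⁻¹ • volume.restrict (Set.Ioo (-Real.pi) Real.pi)

instance isProbabilityMeasure_angleMeasure : IsProbabilityMeasure angleMeasure := by
  refine ⟨?_⟩
  have h : (0 : ℝ) < 2 * Real.pi := by positivity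
  simp only [angleMeasure, Measure.smul_apply, Measure.restrict_apply_univ, Real.volume_Ioo,
    smul_eq_mul]
  rw [← ENNReal.ofReal_mul (by positivity), show Real.pi - -Real.pi = 2 * Real.pi by ring,
    inv_mul_cancel₀ h.ne', ENNReal.ofReal_one]

theorem integrable_angleMeasure {E : Type*} [NormedAddCommGroup E] {f : ℝ → E}
    (hf : Continuous f) : Integrable f angleMeasure :=
  ((hf.integrableOn_Icc (a := -Real.pi) (b := Real.pi)).mono_set
    Set.Ioo_subset_Icc_self).smul_measure ENNReal.ofReal_ne_top

/-- Periodicity moves the angles from `(0, 2π)` to `(-π, π)`, the range used by `polarCoord`. -/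
theorem circleAverage_eq_integral_angleMeasure {E : Type*} [NormedAddCommGroup E]
    [NormedSpace ℝ E] (f : ℂ → E) (c : ℂ) (R : ℝ) :
    Real.circleAverage f c R = ∫ θ, f (circleMap c R θ) ∂angleMeasure := by
  have hper : Function.Periodic (fun θ => f (circleMap c R θ)) (2 * Real.pi) := fun θ => by
    simp only [periodic_circleMap c R θ]
  have h := hper.intervalIntegral_add_eq 0 (-Real.pi)
  rw [zero_add, show -Real.pi + 2 * Real.pi = Real.pi by ring] at h
  rw [Real.circleAverage_def, h, angleMeasure, integral_smul_measure,
    intervalIntegral.integral_of_le (by linarith [Real.pi_pos]), integral_Ioc_eq_integral_Ioo,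
    ENNReal.toReal_ofReal (by positivity)]

/-- The Poisson kernel of the circle of radius `R` at the point of angle `θ`. -/
noncomputable def circlePoisson (R : ℝ) (w : ℂ) (θ : ℝ) : ℝ := poissonKernel 0 w (circleMap 0 R θ)

theorem circlePoisson_nonneg {R : ℝ} {w : ℂ} (hw : ‖w‖ < R) (θ : ℝ) : 0 ≤ circlePoisson R w θ := by
  have hR : 0 ≤ R := (norm_nonneg w).trans hw.le
  simp only [circlePoisson, poissonKernel_def, sub_zero, norm_circleMap_zero, sq_abs]
  exact div_nonneg (by nlinarith [norm_nonneg w]) (by positivity)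

theorem circleMap_sub_ne_zero {R : ℝ} {w : ℂ} (hw : ‖w‖ < R) (θ : ℝ) :
    circleMap 0 R θ - w ≠ 0 := by
  intro h
  have h2 := congrArg norm (sub_eq_zero.1 h)
  rw [norm_circleMap_zero, abs_of_nonneg ((norm_nonneg w).trans hw.le)] at h2
  exact hw.ne h2.symm

theorem continuous_circlePoisson {X : Type*} [TopologicalSpace X] {R : ℝ} {u : X → ℂ} {v : X → ℝ}
    (hu : Continuous u) (hv : Continuous v) (hR : ∀ x, ‖u x‖ < R) :
    Continuous fun x => circlePoisson R (u x) (v x) := by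
  simp only [circlePoisson, poissonKernel_def, sub_zero]
  have hc : Continuous fun x => circleMap 0 R (v x) := (continuous_circleMap 0 R).comp hv
  refine Continuous.div (by fun_prop) (by fun_prop) fun x => ?_
  exact pow_ne_zero _ (norm_ne_zero_iff.2 (circleMap_sub_ne_zero (hR x) _))

theorem circlePoisson_le {R : ℝ} {w : ℂ} (hw : ‖w‖ < R) (θ : ℝ) :
    circlePoisson R w θ ≤ (R + ‖w‖) / (R - ‖w‖) := by
  have hR : 0 ≤ R := (norm_nonneg w).trans hw.le
  have h := re_herglotzRieszKernel_le (c := 0) (circleMap_mem_sphere 0 hR θ)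
    (mem_ball_zero_iff.2 hw)
  rw [circlePoisson, poissonKernel_eq_re_herglotzRieszKernel]
  simpa [herglotzRieszKernel_def] using h

/-- The Poisson integral formula on a circle around `0`. -/
theorem integral_circlePoisson_smul {R : ℝ} {w : ℂ} (hw : ‖w‖ < R) {f : ℂ → ℂ}
    (hf : DiffContOnCl ℂ f (Metric.ball 0 R)) :
    ∫ θ, circlePoisson R w θ • f (circleMap 0 R θ) ∂angleMeasure = f w := by
  have h := hf.circleAverage_poissonKernel_smul (mem_ball_zero_iff.2 hw)
  rw [circleAverage_eq_integral_angleMeasure] at h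
  exact h

theorem integral_circlePoisson {R : ℝ} {w : ℂ} (hw : ‖w‖ < R) :
    ∫ θ, circlePoisson R w θ ∂angleMeasure = 1 := by
  have h := integral_circlePoisson_smul hw (f := fun _ => 1) diffContOnCl_const
  simp only [Complex.real_smul, mul_one, integral_complex_ofReal] at h
  exact_mod_cast h

/-- The mean over a circle around `0` of the Poisson kernel at the points `φ z` is the kernel at
`φ 0`. -/
theorem integral_circlePoisson_comp {r R : ℝ} (hr : 0 < r) {φ : ℂ → ℂ} {U : Set ℂ}
    (hU : Metric.closedBall 0 r ⊆ U) (hφ : DifferentiableOn ℂ φ U)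
    (hR : ∀ z ∈ Metric.closedBall (0 : ℂ) r, ‖φ z‖ < R) (θ : ℝ) :
    ∫ t, circlePoisson R (φ (circleMap 0 r t)) θ ∂angleMeasure = circlePoisson R (φ 0) θ := by
  set ζ := circleMap 0 R θ with hζ
  -- The Poisson kernel at `φ z` is the real part of this holomorphic function of `z`, so the mean
  -- value property applies.
  set H : ℂ → ℂ := fun z => (ζ + φ z) / (ζ - φ z) with hH
  have hφ' := hφ.mono hU
  have hne : ∀ z ∈ Metric.closedBall (0 : ℂ) r, ζ - φ z ≠ 0 :=
    fun z hz => circleMap_sub_ne_zero (hR z hz) θ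
  have hHd : DifferentiableOn ℂ H (Metric.closedBall 0 r) :=
    (hφ'.const_add ζ).div (hφ'.const_sub ζ) hne
  have hd : DiffContOnCl ℂ H (Metric.ball 0 |r|) := by
    rw [abs_of_pos hr]
    exact DifferentiableOn.diffContOnCl (by rwa [closure_ball _ hr.ne'])
  have hav := hd.circleAverage
  rw [circleAverage_eq_integral_angleMeasure] at hav
  have hmem : ∀ t, circleMap 0 r t ∈ Metric.closedBall (0 : ℂ) r :=
    fun t => circleMap_mem_closedBall 0 hr.le t
  have hcont : Continuous fun t => H (circleMap 0 r t) :=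
    hHd.continuousOn.comp_continuous (continuous_circleMap 0 r) hmem
  have hre : ∀ z, circlePoisson R (φ z) θ = (H z).re := fun z => by
    rw [circlePoisson, poissonKernel_eq_re_herglotzRieszKernel]
    simp [herglotzRieszKernel_def, hH, hζ]
  simp only [hre]
  rw [← hav]
  exact integral_re (𝕜 := ℂ) (integrable_angleMeasure hcont)

theorem lintegral_circlePoisson {R : ℝ} {w : ℂ} (hw : ‖w‖ < R) :
    ∫⁻ θ, ENNReal.ofReal (circlePoisson R w θ) ∂angleMeasure = 1 := by
  have hP : Continuous (circlePoisson R w) :=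
    continuous_circlePoisson continuous_const continuous_id fun _ => hw
  rw [← ofReal_integral_eq_lintegral_ofReal (integrable_angleMeasure hP)
    (Filter.Eventually.of_forall (circlePoisson_nonneg hw)), integral_circlePoisson hw,
    ENNReal.ofReal_one]

/-! ### Littlewood subordination on circles -/

/-- For `q ≥ 1`, the function `‖f‖ ^ q` is dominated by its Poisson integral. -/
theorem enorm_rpow_le_lintegral_circlePoisson {R q : ℝ} (hq : 1 ≤ q) {w : ℂ} (hw : ‖w‖ < R)
    {f : ℂ → ℂ} (hf : DiffContOnCl ℂ f (Metric.ball 0 R)) :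
    ‖f w‖ₑ ^ q ≤ ∫⁻ θ, ENNReal.ofReal (circlePoisson R w θ) * ‖f (circleMap 0 R θ)‖ₑ ^ q
      ∂angleMeasure := by
  have hR : 0 < R := (norm_nonneg w).trans_lt hw
  have hP : Continuous (circlePoisson R w) :=
    continuous_circlePoisson continuous_const continuous_id fun _ => hw
  have hPm : Measurable fun θ => ENNReal.ofReal (circlePoisson R w θ) :=
    ENNReal.measurable_ofReal.comp hP.measurable
  have hfc : Continuous fun θ => f (circleMap 0 R θ) := by
    refine hf.continuousOn.comp_continuous (continuous_circleMap 0 R) fun θ => ?_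
    rw [closure_ball _ hR.ne']
    exact circleMap_mem_closedBall 0 hR.le θ
  set ν := angleMeasure.withDensity fun θ => ENNReal.ofReal (circlePoisson R w θ) with hν
  have : IsProbabilityMeasure ν := ⟨by
    rw [hν, withDensity_apply _ MeasurableSet.univ, Measure.restrict_univ,
      lintegral_circlePoisson hw]⟩
  have hq0 : 0 < q := by linarith
  have h1 : ‖f w‖ₑ ≤ ∫⁻ θ, ‖f (circleMap 0 R θ)‖ₑ ∂ν := by
    rw [hν, lintegral_withDensity_eq_lintegral_mul₀ hPm.aemeasurable
      hfc.measurable.enorm.aemeasurable, ← integral_circlePoisson_smul hw hf]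
    refine (enorm_integral_le_lintegral_enorm _).trans_eq (lintegral_congr fun θ => ?_)
    rw [enorm_smul, Pi.mul_apply, Real.enorm_of_nonneg (circlePoisson_nonneg hw θ)]
  -- Jensen's inequality, as monotonicity of `L^q` norms in `q` for the probability measure `ν`.
  have h2 := eLpNorm'_le_eLpNorm'_of_exponent_le one_pos hq ν
    (f := fun θ => f (circleMap 0 R θ)) hfc.aestronglyMeasurable
  simp only [eLpNorm', ENNReal.rpow_one, div_one] at h2
  have h3 := ENNReal.rpow_le_rpow (h1.trans h2) hq0.le
  rw [← ENNReal.rpow_mul, one_div, inv_mul_cancel₀ hq0.ne', ENNReal.rpow_one] at h3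
  refine h3.trans_eq ?_
  rw [hν, lintegral_withDensity_eq_lintegral_mul₀ hPm.aemeasurable
    (hfc.measurable.enorm.pow_const q).aemeasurable]
  rfl

/-- Littlewood subordination on circles. -/
theorem lintegral_circle_comp_le {r R q : ℝ} (hq : 1 ≤ q) (hr : 0 < r) {φ : ℂ → ℂ} {U : Set ℂ}
    (hU : Metric.closedBall 0 r ⊆ U) (hφ : DifferentiableOn ℂ φ U)
    (hR : ∀ z ∈ Metric.closedBall (0 : ℂ) r, ‖φ z‖ < R) {f : ℂ → ℂ}
    (hf : DiffContOnCl ℂ f (Metric.ball 0 R)) :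
    ∫⁻ t, ‖f (φ (circleMap 0 r t))‖ₑ ^ q ∂angleMeasure ≤
      ENNReal.ofReal ((R + ‖φ 0‖) / (R - ‖φ 0‖)) *
        ∫⁻ θ, ‖f (circleMap 0 R θ)‖ₑ ^ q ∂angleMeasure := by
  have h0 : ‖φ 0‖ < R := hR 0 (Metric.mem_closedBall_self hr.le)
  have hR0 : 0 < R := (norm_nonneg _).trans_lt h0
  have hmem : ∀ t, circleMap 0 r t ∈ Metric.closedBall (0 : ℂ) r :=
    fun t => circleMap_mem_closedBall 0 hr.le t
  have hφc : Continuous fun t => φ (circleMap 0 r t) :=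
    (hφ.mono hU).continuousOn.comp_continuous (continuous_circleMap 0 r) hmem
  have hfc : Continuous fun θ => f (circleMap 0 R θ) := by
    refine hf.continuousOn.comp_continuous (continuous_circleMap 0 R) fun θ => ?_
    rw [closure_ball _ hR0.ne']
    exact circleMap_mem_closedBall 0 hR0.le θ
  have hPc : Continuous fun x : ℝ × ℝ => circlePoisson R (φ (circleMap 0 r x.1)) x.2 :=
    continuous_circlePoisson (hφc.comp continuous_fst) continuous_snd fun x => hR _ (hmem _)
  calc ∫⁻ t, ‖f (φ (circleMap 0 r t))‖ₑ ^ q ∂angleMeasure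
      ≤ ∫⁻ t, ∫⁻ θ, ENNReal.ofReal (circlePoisson R (φ (circleMap 0 r t)) θ) *
          ‖f (circleMap 0 R θ)‖ₑ ^ q ∂angleMeasure ∂angleMeasure :=
        lintegral_mono fun t => enorm_rpow_le_lintegral_circlePoisson hq (hR _ (hmem t)) hf
    _ = ∫⁻ θ, ∫⁻ t, ENNReal.ofReal (circlePoisson R (φ (circleMap 0 r t)) θ) *
          ‖f (circleMap 0 R θ)‖ₑ ^ q ∂angleMeasure ∂angleMeasure := by
        refine lintegral_lintegral_swap (Measurable.aemeasurable ?_)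
        exact (ENNReal.measurable_ofReal.comp hPc.measurable).mul
          ((hfc.comp continuous_snd).measurable.enorm.pow_const q)
    _ = ∫⁻ θ, ENNReal.ofReal (circlePoisson R (φ 0) θ) * ‖f (circleMap 0 R θ)‖ₑ ^ q
          ∂angleMeasure := by
        refine lintegral_congr fun θ => ?_
        have hc : Continuous fun t => circlePoisson R (φ (circleMap 0 r t)) θ :=
          continuous_circlePoisson hφc continuous_const fun t => hR _ (hmem t)
        rw [lintegral_mul_const _ hc.measurable.ennreal_ofReal,
          ← ofReal_integral_eq_lintegral_ofReal (integrable_angleMeasure hc)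
          (Filter.Eventually.of_forall fun t => circlePoisson_nonneg (hR _ (hmem t)) θ),
          integral_circlePoisson_comp hr hU hφ hR]
    _ ≤ ∫⁻ θ, ENNReal.ofReal ((R + ‖φ 0‖) / (R - ‖φ 0‖)) * ‖f (circleMap 0 R θ)‖ₑ ^ q
          ∂angleMeasure := by
        gcongr with θ
        exact circlePoisson_le h0 θ
    _ = _ := lintegral_const_mul _ (hfc.measurable.enorm.pow_const q)

/-! ### Boundary behaviour of self-maps -/

/-- A consequence of the Schwarz–Pick lemma: a self-map of the disk does not approach the boundary
faster than its argument. -/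
theorem IsAnalyticSelfMap.mul_one_sub_norm_lt {φ : ℂ → ℂ} (hφ : IsAnalyticSelfMap φ) {z : ℂ}
    (hz : ‖z‖ < 1) : (1 - ‖φ 0‖) / 8 * (1 - ‖z‖) < 1 - ‖φ z‖ := by
  have hmem : ∀ w : ℂ, ‖w‖ < 1 → ‖φ w‖ < 1 := fun w hw =>
    mem_ball_zero_iff.1 (hφ.2 (mem_ball_zero_iff.2 hw))
  set a := φ 0 with ha
  have ha1 : ‖a‖ < 1 := hmem 0 (by simp)
  have hlow : ∀ b : ℂ, ‖b‖ < 1 → 1 - ‖a‖ ≤ ‖1 - starRingEnd ℂ a * b‖ := fun b hb => by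
    have h1 := norm_sub_norm_le 1 (starRingEnd ℂ a * b)
    rw [norm_one, norm_mul, RCLike.norm_conj] at h1
    nlinarith [norm_nonneg a, norm_nonneg b]
  have hid : ∀ b : ℂ, ‖1 - starRingEnd ℂ a * b‖ ^ 2 - ‖b - a‖ ^ 2 =
      (1 - ‖a‖ ^ 2) * (1 - ‖b‖ ^ 2) := fun b => by
    simp only [Complex.sq_norm, Complex.normSq_apply, Complex.sub_re, Complex.sub_im,
      Complex.mul_re, Complex.mul_im, Complex.conj_re, Complex.conj_im, Complex.one_re,
      Complex.one_im]
    ring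
  -- Following `φ` by the disk automorphism that sends `a` to `0` reduces to the Schwarz lemma;
  -- `hid` is the usual identity for that automorphism.
  set ψ : ℂ → ℂ := fun w => (φ w - a) / (1 - starRingEnd ℂ a * φ w) with hψ
  have hne : ∀ w : ℂ, ‖w‖ < 1 → 1 - starRingEnd ℂ a * φ w ≠ 0 := fun w hw h => by
    have := hlow _ (hmem w hw)
    rw [h, norm_zero] at this
    linarith
  have hd : DifferentiableOn ℂ ψ (Metric.ball 0 1) :=
    DifferentiableOn.div (hφ.1.sub_const a) ((hφ.1.const_mul _).const_sub 1)
      fun w hw => hne w (mem_ball_zero_iff.1 hw)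
  have hmaps : Set.MapsTo ψ (Metric.ball 0 1) (Metric.closedBall 0 1) := fun w hw => by
    have hw := mem_ball_zero_iff.1 hw
    rw [mem_closedBall_zero_iff, hψ, norm_div, div_le_one (norm_pos_iff.2 (hne w hw))]
    refine (sq_le_sq₀ (norm_nonneg _) (norm_nonneg _)).1 ?_
    have := hid (φ w)
    have h2 := hmem w hw
    nlinarith [mul_nonneg (show 0 ≤ 1 - ‖a‖ ^ 2 by nlinarith [norm_nonneg a])
      (show 0 ≤ 1 - ‖φ w‖ ^ 2 by nlinarith [norm_nonneg (φ w)])]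
  have hle := Complex.norm_le_norm_of_mapsTo_ball hd hmaps (by simp [hψ, ha]) hz
  rw [hψ, norm_div, div_le_iff₀ (norm_pos_iff.2 (hne z hz))] at hle
  have h1 := hid (φ z)
  have h2 := hlow _ (hmem z hz)
  have h3 := hmem z hz
  set x := ‖1 - starRingEnd ℂ a * φ z‖
  have h4 : ‖φ z - a‖ ^ 2 ≤ ‖z‖ ^ 2 * x ^ 2 := by
    rw [← mul_pow]
    exact pow_le_pow_left₀ (norm_nonneg _) hle 2
  have h5 : (1 - ‖a‖) ^ 2 ≤ x ^ 2 := pow_le_pow_left₀ (by linarith) h2 2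
  have h6 : (1 - ‖z‖ ^ 2) * (1 - ‖a‖) ^ 2 ≤ (1 - ‖a‖ ^ 2) * (1 - ‖φ z‖ ^ 2) := by
    nlinarith [mul_le_mul_of_nonneg_left h5 (show 0 ≤ 1 - ‖z‖ ^ 2 by nlinarith [norm_nonneg z])]
  have h7 : (1 - ‖z‖ ^ 2) * (1 - ‖a‖) ≤ (1 + ‖a‖) * (1 - ‖φ z‖ ^ 2) := by
    refine le_of_mul_le_mul_right (?_ : _ * (1 - ‖a‖) ≤ _ * (1 - ‖a‖)) (by linarith)
    nlinarith
  have h8 : (1 - ‖z‖) * (1 - ‖a‖) ≤ (1 - ‖z‖ ^ 2) * (1 - ‖a‖) := by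
    refine mul_le_mul_of_nonneg_right ?_ (by linarith)
    nlinarith [norm_nonneg z]
  have h9 : (1 + ‖a‖) * (1 - ‖φ z‖ ^ 2) ≤ 2 * (2 * (1 - ‖φ z‖)) := by
    refine mul_le_mul (by linarith) ?_ (by nlinarith [norm_nonneg (φ z)]) (by norm_num)
    nlinarith [norm_nonneg (φ z)]
  -- The estimates give the non-strict bound with `4`; `8` leaves room for strictness.
  nlinarith [norm_nonneg z]

/-! ### Polar coordinates and the radial weight -/

theorem mem_unitDisk {z : ℂ} : z ∈ unitDisk ↔ ‖z‖ < 1 := mem_ball_zero_iff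

theorem measurableSet_unitDisk : MeasurableSet unitDisk := Metric.isOpen_ball.measurableSet

/-- Measurability is asked only on the disk, since `f ∘ φ` is uncontrolled outside it. -/
theorem lintegral_weightedArea (α : ℝ) {g : ℂ → ℝ≥0∞} (hg : Measurable (unitDisk.indicator g)) :
    ∫⁻ z, g z ∂(weightedArea α) = ∫⁻ z, ENNReal.ofReal
      (Real.pi⁻¹ * ((α + 1) * (1 - ‖z‖ ^ 2) ^ α)) * unitDisk.indicator g z := by
  rw [weightedArea, lintegral_withDensity_eq_lintegral_mul₀
    (Bergman.density_measurable α).aemeasurable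
    ((aemeasurable_indicator_iff measurableSet_unitDisk).1 hg.aemeasurable),
    ← lintegral_indicator measurableSet_unitDisk]
  refine lintegral_congr fun z => ?_
  by_cases hz : z ∈ unitDisk <;> simp [hz]

/-- Integration over the disk in polar coordinates. -/
theorem lintegral_weightedArea_polar (α : ℝ) {g : ℂ → ℝ≥0∞}
    (hg : Measurable (unitDisk.indicator g)) :
    ∫⁻ z, g z ∂(weightedArea α) = ∫⁻ r in Set.Ioo (0 : ℝ) 1,
      ENNReal.ofReal (2 * ((α + 1) * (1 - r ^ 2) ^ α)) *
        (ENNReal.ofReal r * ∫⁻ θ, g (circleMap 0 r θ) ∂angleMeasure) := by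
  have hsymm : ∀ x : ℝ × ℝ, Complex.polarCoord.symm x = circleMap 0 x.1 x.2 := fun x => by
    rw [Complex.polarCoord_symm_apply, circleMap_zero, Complex.exp_mul_I]
    simp
  have hc : Measurable fun x : ℝ × ℝ => circleMap 0 x.1 x.2 := by
    simp only [circleMap_zero]
    fun_prop
  rw [lintegral_weightedArea α hg, ← Complex.lintegral_comp_polarCoord_symm,
    polarCoord_target, Measure.volume_eq_prod, setLIntegral_prod]
  · rw [← lintegral_indicator measurableSet_Ioi, ← lintegral_indicator measurableSet_Ioo]
    refine lintegral_congr fun r => ?_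
    by_cases h0 : 0 < r
    swap
    · simp [h0]
    by_cases h1 : r < 1
    swap
    · simp [h0, h1, hsymm, mem_unitDisk, abs_of_pos h0]
    have hp : (0 : ℝ) < 2 * Real.pi := by positivity
    have hm : Measurable fun θ => unitDisk.indicator g (circleMap 0 r θ) :=
      hg.comp (continuous_circleMap 0 r).measurable
    have hind : ∀ θ, unitDisk.indicator g (circleMap 0 r θ) = g (circleMap 0 r θ) := fun θ =>
      Set.indicator_of_mem (mem_unitDisk.2 (by simpa [abs_of_pos h0] using h1)) g
    simp only [hind] at hm
    simp only [Set.indicator_of_mem (Set.mem_Ioi.2 h0), Set.indicator_of_mem (Set.mem_Ioo.2 ⟨h0, h1⟩),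
      hsymm, hind, norm_circleMap_zero, sq_abs, smul_eq_mul]
    rw [lintegral_const_mul _ (hm.const_mul _), lintegral_const_mul _ hm, angleMeasure,
      lintegral_smul_measure, smul_eq_mul]
    have e : Real.pi⁻¹ * ((α + 1) * (1 - r ^ 2) ^ α) =
        (2 * ((α + 1) * (1 - r ^ 2) ^ α)) * (2 * Real.pi)⁻¹ := by
      field_simp
    rw [e, ENNReal.ofReal_mul' (by positivity)]
    ring
  · simp only [hsymm, smul_eq_mul]
    refine Measurable.aemeasurable ?_
    exact measurable_fst.ennreal_ofReal.mul
      (((Bergman.density_measurable α).comp hc).mul (hg.comp hc))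

/-- A linear substitution in the radial integral. -/
theorem lintegral_Ioo_comp_affine_le {c : ℝ} (hc : 0 < c) (hc1 : c ≤ 1) (Φ : ℝ → ℝ≥0∞) :
    ∫⁻ r in Set.Ioo (0 : ℝ) 1, Φ (1 - c * (1 - r)) ≤
      ENNReal.ofReal c⁻¹ * ∫⁻ R in Set.Ioo (0 : ℝ) 1, Φ R := by
  have h := lintegral_image_eq_lintegral_abs_deriv_mul (s := Set.Ioo (0 : ℝ) 1)
    (f := fun r => 1 - c * (1 - r)) (f' := fun _ => c) measurableSet_Ioo
    (fun x _ => by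
      have := (((hasDerivAt_id x).const_sub 1).const_mul c).const_sub 1
      simpa using this.hasDerivWithinAt)
    (fun x _ y _ hxy => by
      have : c * (1 - x) = c * (1 - y) := by simpa using hxy
      linarith [mul_left_cancel₀ hc.ne' this]) Φ
  rw [abs_of_pos hc, lintegral_const_mul' _ _ ENNReal.ofReal_ne_top] at h
  have h2 : ENNReal.ofReal c⁻¹ * ENNReal.ofReal c = 1 := by
    rw [← ENNReal.ofReal_mul (by positivity), inv_mul_cancel₀ hc.ne', ENNReal.ofReal_one]
  calc _ = ENNReal.ofReal c⁻¹ * (ENNReal.ofReal c *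
        ∫⁻ r in Set.Ioo (0 : ℝ) 1, Φ (1 - c * (1 - r))) := by rw [← mul_assoc, h2, one_mul]
    _ = ENNReal.ofReal c⁻¹ * ∫⁻ R in (fun r => 1 - c * (1 - r)) '' Set.Ioo (0 : ℝ) 1, Φ R := by
        rw [h]
    _ ≤ _ := by
        gcongr
        rintro _ ⟨r, ⟨h0, h1⟩, rfl⟩
        constructor <;> simp only <;> nlinarith

/-- With `R = 1 - c(1 - r)`, each of `1 - r²` and `1 - R²` is at most `2 / c` times the other; the
two directions serve the two signs of `α`. -/
theorem weight_le_weight_affine {c r : ℝ} (α : ℝ) (hc : 0 < c) (hc1 : c ≤ 1) (h0 : 0 < r)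
    (h1 : r < 1) : (1 - r ^ 2) ^ α ≤ (2 / c) ^ |α| * (1 - (1 - c * (1 - r)) ^ 2) ^ α := by
  have hR0 : 0 ≤ 1 - c * (1 - r) := by nlinarith
  have hR1 : 0 < c * (1 - r) := by nlinarith
  have hA : 0 < 1 - r ^ 2 := by nlinarith
  have hB : 0 < 1 - (1 - c * (1 - r)) ^ 2 := by nlinarith
  have hBA : 1 - (1 - c * (1 - r)) ^ 2 ≤ 2 / c * (1 - r ^ 2) := by
    rw [div_mul_eq_mul_div, le_div_iff₀ hc]
    have : 1 - (1 - c * (1 - r)) ^ 2 ≤ 2 * (1 - r) := by nlinarith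
    nlinarith
  have hAB : 1 - r ^ 2 ≤ 2 / c * (1 - (1 - c * (1 - r)) ^ 2) := by
    rw [div_mul_eq_mul_div, le_div_iff₀ hc]
    nlinarith
  rcases le_total 0 α with h | h
  · rw [abs_of_nonneg h, ← Real.mul_rpow (by positivity) hB.le]
    exact Real.rpow_le_rpow hA.le hAB h
  · rw [abs_of_nonpos h]
    have h2 := Real.rpow_le_rpow hB.le hBA (neg_nonneg.2 h)
    rw [Real.mul_rpow (by positivity) hA.le, Real.rpow_neg hA.le, Real.rpow_neg hB.le] at h2
    have hA' := Real.rpow_pos_of_pos hA α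
    have hB' := Real.rpow_pos_of_pos hB α
    rw [← div_eq_mul_inv, le_div_iff₀ hA', inv_mul_le_iff₀ hB'] at h2
    linarith

theorem measurable_indicator_enorm_rpow {f : ℂ → ℂ} (hf : ContinuousOn f unitDisk) (q : ℝ) :
    Measurable (unitDisk.indicator fun z => ‖f z‖ₑ ^ q) := by
  classical
  have h : ContinuousOn (fun z => ‖f z‖ₑ ^ q) unitDisk :=
    (ENNReal.continuous_rpow_const.comp_continuousOn hf.enorm)
  rw [← Set.piecewise_eq_indicator]
  exact h.measurable_piecewise continuousOn_const measurableSet_unitDisk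

/-! ### Littlewood subordination on the disk -/

/-- The constant in the norm estimate for composition operators. -/
noncomputable def compConst (α a : ℝ) : ℝ :=
  (8 / (1 - a)) * ((16 / (1 - a)) ^ |α| * (2 * (16 / (1 - a))))

/-- Littlewood subordination for the weighted area measure. -/
theorem lintegral_comp_weightedArea_le {α q : ℝ} (hα : -1 < α) (hq : 1 ≤ q) {φ f : ℂ → ℂ}
    (hφ : IsAnalyticSelfMap φ) (hf : IsAnalyticOnDisk f) :
    ∫⁻ z, ‖f (φ z)‖ₑ ^ q ∂(weightedArea α) ≤
      ENNReal.ofReal (compConst α ‖φ 0‖) * ∫⁻ z, ‖f z‖ₑ ^ q ∂(weightedArea α) := by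
  have ha1 : ‖φ 0‖ < 1 := mem_unitDisk.1 (hφ.2 (mem_unitDisk.2 (by simp)))
  set c := (1 - ‖φ 0‖) / 8 with hc
  have hc0 : 0 < c := by rw [hc]; linarith
  have hc8 : c ≤ 1 / 8 := by rw [hc]; linarith [norm_nonneg (φ 0)]
  set M : ℝ → ℝ≥0∞ := fun R => ∫⁻ θ, ‖f (circleMap 0 R θ)‖ₑ ^ q ∂angleMeasure with hM
  -- The factors come from the weight, the polar Jacobian (`r ≤ 2R`) and the Harnack bound on the
  -- Poisson kernel. The factor `c⁻¹` of `compConst` comes from the substitution.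
  set K : ℝ := (2 / c) ^ |α| * (2 * (2 / c)) with hK
  have hKc : compConst α ‖φ 0‖ = c⁻¹ * K := by
    have e1 : c⁻¹ = 8 / (1 - ‖φ 0‖) := by rw [hc, inv_div]
    have e2 : 2 / c = 16 / (1 - ‖φ 0‖) := by rw [div_eq_mul_inv, e1]; ring
    rw [compConst, hK, e1, e2]
  rw [lintegral_weightedArea_polar α (g := fun z => ‖f (φ z)‖ₑ ^ q)
      (measurable_indicator_enorm_rpow (hf.continuousOn.comp hφ.1.continuousOn hφ.2) q),
    lintegral_weightedArea_polar α (measurable_indicator_enorm_rpow hf.continuousOn q), hKc,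
    ENNReal.ofReal_mul (by positivity)]
  set Φ : ℝ → ℝ≥0∞ := fun R =>
    ENNReal.ofReal (2 * ((α + 1) * (1 - R ^ 2) ^ α)) * (ENNReal.ofReal R * M R) with hΦ
  have key : ∀ r ∈ Set.Ioo (0 : ℝ) 1, ENNReal.ofReal (2 * ((α + 1) * (1 - r ^ 2) ^ α)) *
      (ENNReal.ofReal r * ∫⁻ θ, ‖f (φ (circleMap 0 r θ))‖ₑ ^ q ∂angleMeasure) ≤
      ENNReal.ofReal K * Φ (1 - c * (1 - r)) := by
    rintro r ⟨h0, h1⟩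
    -- By Schwarz–Pick, `1 - ‖φ z‖ > c(1 - ‖z‖) ≥ 1 - R` for `‖z‖ ≤ r`, so `φ` stays strictly inside
    -- radius `R`.
    set R := 1 - c * (1 - r) with hR
    have hR1 : R < 1 := by nlinarith
    have hRh : 1 / 2 ≤ R := by nlinarith
    have hRa : c ≤ R - ‖φ 0‖ := by
      have : ‖φ 0‖ = 1 - 8 * c := by rw [hc]; ring
      nlinarith
    have hsub := lintegral_circle_comp_le (R := R) hq h0 (U := unitDisk)
      (Metric.closedBall_subset_ball h1) hφ.1
      (fun z hz => by
        have hz := mem_closedBall_zero_iff.1 hz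
        have := hφ.mul_one_sub_norm_lt (hz.trans_lt h1)
        nlinarith) (f := f)
      (DifferentiableOn.diffContOnCl (hf.mono (by
        rw [closure_ball _ (by linarith)]
        exact Metric.closedBall_subset_ball hR1)))
    have hfac : (R + ‖φ 0‖) / (R - ‖φ 0‖) ≤ 2 / c :=
      div_le_div₀ (by norm_num) (by linarith) hc0 hRa
    have hw := weight_le_weight_affine α hc0 (by linarith) h0 h1
    rw [← hR] at hw
    calc _ ≤ ENNReal.ofReal ((2 / c) ^ |α| * (2 * ((α + 1) * (1 - R ^ 2) ^ α))) *
          (ENNReal.ofReal (2 * R) * (ENNReal.ofReal (2 / c) * M R)) := by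
          gcongr ENNReal.ofReal ?_ * (ENNReal.ofReal ?_ * ?_)
          · nlinarith [mul_le_mul_of_nonneg_left hw (show 0 ≤ 2 * (α + 1) by linarith)]
          · linarith
          · exact hsub.trans (by gcongr)
      _ = ENNReal.ofReal K * Φ R := by
          rw [ENNReal.ofReal_mul (p := (2 / c) ^ |α|) (by positivity),
            ENNReal.ofReal_mul (p := 2) (q := R) (by norm_num), hK,
            ENNReal.ofReal_mul (p := (2 / c) ^ |α|) (by positivity),
            ENNReal.ofReal_mul (p := 2) (q := 2 / c) (by norm_num)]
          simp only [hΦ]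
          ring
  calc _ ≤ ∫⁻ r in Set.Ioo (0 : ℝ) 1, ENNReal.ofReal K * Φ (1 - c * (1 - r)) :=
        setLIntegral_mono' measurableSet_Ioo key
    _ = ENNReal.ofReal K * ∫⁻ r in Set.Ioo (0 : ℝ) 1, Φ (1 - c * (1 - r)) :=
        lintegral_const_mul' _ _ ENNReal.ofReal_ne_top
    _ ≤ ENNReal.ofReal K * (ENNReal.ofReal c⁻¹ * ∫⁻ R in Set.Ioo (0 : ℝ) 1, Φ R) := by
        gcongr
        exact lintegral_Ioo_comp_affine_le hc0 (by linarith) Φ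
    _ = _ := by ring

/-! ### Weighted composition operators and point evaluations -/

theorem IsAnalyticOnDisk.aestronglyMeasurable {h : ℂ → ℂ} (hd : IsAnalyticOnDisk h) (α : ℝ) :
    AEStronglyMeasurable h (weightedArea α) :=
  (hd.continuousOn.aestronglyMeasurable measurableSet_unitDisk).mono_ac
    (withDensity_absolutelyContinuous _ _)

namespace Bergman

variable {p : ℝ≥0∞} {α : ℝ}

/-- The element of `A^p_α` given by an analytic function with finite norm. -/
noncomputable def ofMemLp (h : ℂ → ℂ) (hd : IsAnalyticOnDisk h)
    (hp : MemLp h p (weightedArea α)) : Bergman p α :=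
  ⟨unitDisk.indicator h, hd.congr fun z hz => by simp [hz], fun z hz => by simp [hz],
    hp.indicator measurableSet_unitDisk⟩

theorem ofMemLp_apply {h : ℂ → ℂ} (hd : IsAnalyticOnDisk h) (hp : MemLp h p (weightedArea α))
    {z : ℂ} (hz : z ∈ unitDisk) : ofMemLp h hd hp z = h z :=
  Set.indicator_of_mem hz h

theorem isAnalyticOnDisk (f : Bergman p α) : IsAnalyticOnDisk f := f.2.1

theorem add_apply (f g : Bergman p α) (z : ℂ) : (f + g : Bergman p α) z = f z + g z := rfl

theorem sub_apply (f g : Bergman p α) (z : ℂ) : (f - g : Bergman p α) z = f z - g z := rfl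

theorem smul_apply (c : ℂ) (f : Bergman p α) (z : ℂ) : (c • f : Bergman p α) z = c * f z := rfl

theorem zero_apply (z : ℂ) : (0 : Bergman p α) z = 0 := rfl

theorem one_apply [Fact (-1 < α)] {z : ℂ} (hz : z ∈ unitDisk) : one p α z = 1 :=
  Set.indicator_of_mem hz fun _ => (1 : ℂ)

theorem mulZ_apply [Fact (1 ≤ p)] [Fact (-1 < α)] (f : Bergman p α) (z : ℂ) :
    mulZ p α f z = z * f z := rfl

theorem eLpNorm_comp_le [hp1 : Fact (1 ≤ p)] (hp : p ≠ ∞) [hα : Fact (-1 < α)] {φ f : ℂ → ℂ}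
    (hφ : IsAnalyticSelfMap φ) (hf : IsAnalyticOnDisk f) :
    eLpNorm (fun z => f (φ z)) p (weightedArea α) ≤
      ENNReal.ofReal (compConst α ‖φ 0‖) ^ (1 / p.toReal) * eLpNorm f p (weightedArea α) := by
  have h0 : p ≠ 0 := (zero_lt_one.trans_le hp1.out).ne'
  have hq : 1 ≤ p.toReal := by
    rw [← ENNReal.toReal_one]
    exact ENNReal.toReal_mono hp hp1.out
  rw [eLpNorm_eq_lintegral_rpow_enorm_toReal h0 hp, eLpNorm_eq_lintegral_rpow_enorm_toReal h0 hp,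
    ← ENNReal.mul_rpow_of_nonneg _ _ (by positivity)]
  exact ENNReal.rpow_le_rpow (lintegral_comp_weightedArea_le hα.out hq hφ hf) (by positivity)

theorem eLpNorm_weightedComp_le [Fact (1 ≤ p)] (hp : p ≠ ∞) [Fact (-1 < α)] {m φ f : ℂ → ℂ}
    {C : ℝ} (hm : ∀ z ∈ unitDisk, ‖m z‖ ≤ C) (hφ : IsAnalyticSelfMap φ)
    (hf : IsAnalyticOnDisk f) :
    eLpNorm (fun z => m z * f (φ z)) p (weightedArea α) ≤ ENNReal.ofReal C *
      (ENNReal.ofReal (compConst α ‖φ 0‖) ^ (1 / p.toReal) * eLpNorm f p (weightedArea α)) := by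
  refine (eLpNorm_le_mul_eLpNorm_of_ae_le_mul (g := fun z => f (φ z)) (c := C) ?_ p).trans
    (mul_le_mul_right (eLpNorm_comp_le hp hφ hf) _)
  filter_upwards [ae_weightedArea α] with z hz
  rw [norm_mul]
  exact mul_le_mul_of_nonneg_right (hm z hz) (norm_nonneg _)

/-- Bounded weighted composition operators exist on `A^p_α`. -/
theorem exists_isWeightedComposition [Fact (1 ≤ p)] (hp : p ≠ ∞) [Fact (-1 < α)] {m φ : ℂ → ℂ}
    (hm : IsHInfty m) (hφ : IsAnalyticSelfMap φ) :
    ∃ T : Bergman p α →L[ℂ] Bergman p α, IsWeightedComposition T m φ := by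
  obtain ⟨hmd, C, hC⟩ := hm
  set K := ENNReal.ofReal C * ENNReal.ofReal (compConst α ‖φ 0‖) ^ (1 / p.toReal) with hK
  have hKt : K ≠ ∞ := ENNReal.mul_ne_top ENNReal.ofReal_ne_top
    (ENNReal.rpow_ne_top_of_nonneg (by positivity) ENNReal.ofReal_ne_top)
  have hbd : ∀ f : Bergman p α, eLpNorm (fun z => m z * f (φ z)) p (weightedArea α) ≤
      K * eLpNorm f p (weightedArea α) := fun f => by
    rw [hK, mul_assoc]
    exact eLpNorm_weightedComp_le hp hC hφ f.isAnalyticOnDisk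
  have hd : ∀ f : Bergman p α, IsAnalyticOnDisk fun z => m z * f (φ z) := fun f =>
    hmd.mul (f.isAnalyticOnDisk.comp hφ.1 hφ.2)
  have hL : ∀ f : Bergman p α, MemLp (fun z => m z * f (φ z)) p (weightedArea α) := fun f =>
    ⟨(hd f).aestronglyMeasurable α, (hbd f).trans_lt
      (ENNReal.mul_lt_top hKt.lt_top f.memLp.eLpNorm_lt_top)⟩
  let T : Bergman p α →ₗ[ℂ] Bergman p α :=
    { toFun := fun f => ofMemLp _ (hd f) (hL f)
      map_add' := fun f g => ext fun z hz => by
        rw [add_apply, ofMemLp_apply (hd (f + g)) (hL (f + g)) hz, ofMemLp_apply (hd f) (hL f) hz,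
          ofMemLp_apply (hd g) (hL g) hz, add_apply, mul_add]
      map_smul' := fun c f => ext fun z hz => by
        rw [RingHom.id_apply, smul_apply, ofMemLp_apply (hd (c • f)) (hL (c • f)) hz,
          ofMemLp_apply (hd f) (hL f) hz, smul_apply]
        ring }
  have hT : ∀ f, ∀ z ∈ unitDisk, T f z = m z * f (φ z) := fun f z hz => ofMemLp_apply (hd f) (hL f) hz
  refine ⟨T.mkContinuous K.toReal fun f => ?_, hT⟩
  rw [norm_def, norm_def, ← ENNReal.toReal_mul]
  refine ENNReal.toReal_mono (ENNReal.mul_ne_top hKt f.memLp.eLpNorm_ne_top) (le_trans ?_ (hbd f))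
  refine (eLpNorm_congr_ae ?_).le
  filter_upwards [ae_weightedArea α] with z hz
  exact hT f z hz

/-- Point evaluations are bounded on `A^p_α`. -/
theorem exists_norm_apply_le [Fact (1 ≤ p)] (hp : p ≠ ∞) [Fact (-1 < α)] {w : ℂ}
    (hw : w ∈ unitDisk) : ∃ C : ℝ, ∀ f : Bergman p α, ‖f w‖ ≤ C * ‖f‖ := by
  -- Composition with the constant map `w` is bounded and sends `f` to `f w` times the function `1`.
  obtain ⟨T, hT⟩ := exists_isWeightedComposition (p := p) (α := α) hp (m := fun _ => 1)
    (φ := fun _ => w) ⟨differentiableOn_const _, 1, by simp⟩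
    ⟨differentiableOn_const _, fun _ _ => hw⟩
  have h1 : 0 < ‖one p α‖ := by
    refine norm_pos_iff.2 fun h => ?_
    have h2 := one_apply (p := p) (α := α) hw
    rw [h, zero_apply] at h2
    exact zero_ne_one h2
  refine ⟨‖T‖ / ‖one p α‖, fun f => ?_⟩
  have hTf : T f = f w • one p α := ext fun z hz => by
    rw [hT f z hz, smul_apply, one_apply hz, one_mul, mul_one]
  have h3 := T.le_opNorm f
  rw [hTf, norm_smul] at h3
  rw [div_mul_eq_mul_div, le_div_iff₀ h1]
  exact h3

/-! ### Division, powers and commutant of `M_z` -/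

/-- Division by `z - w` in `A^p_α`. -/
theorem exists_eq_smul_one_add (hα : -1 < α) (f : Bergman p α) {w : ℂ} (hw : w ∈ unitDisk) :
    ∃ g : Bergman p α, ∀ z ∈ unitDisk, f z = f w + (z * g z - w * g z) := by
  have hd : IsAnalyticOnDisk (dslope f w) :=
    (Complex.differentiableOn_dslope (Metric.isOpen_ball.mem_nhds hw)).2 f.isAnalyticOnDisk
  obtain ⟨ρ, hρ, hball⟩ := Metric.nhds_basis_closedBall.mem_iff.1
    (Metric.isOpen_ball.mem_nhds hw : unitDisk ∈ nhds w)
  obtain ⟨A, hA⟩ := (isCompact_closedBall w ρ).exists_bound_of_continuousOn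
    (hd.continuousOn.mono hball)
  have := isFiniteMeasure_weightedArea α hα
  have hL : MemLp (dslope f w) p (weightedArea α) := by
    refine MemLp.mono (((memLp_const (|A| + ρ⁻¹ * ‖f w‖)).add (f.memLp.norm.const_mul ρ⁻¹)))
      (hd.aestronglyMeasurable α) ?_
    filter_upwards with z
    rw [Pi.add_apply, Real.norm_of_nonneg (by positivity)]
    -- Near `w` the difference quotient is bounded by compactness; elsewhere its denominator exceeds
    -- `ρ`.
    by_cases hz : z ∈ Metric.closedBall w ρ
    · have h1 := hA z hz
      have h2 : 0 ≤ ρ⁻¹ * ‖f w‖ := by positivity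
      have h3 : 0 ≤ ρ⁻¹ * ‖f z‖ := by positivity
      linarith [le_abs_self A]
    · rw [Metric.mem_closedBall, not_le, dist_eq_norm] at hz
      have hzw : z ≠ w := by
        rintro rfl
        rw [sub_self, norm_zero] at hz
        exact hz.not_gt hρ
      rw [dslope_of_ne _ hzw, slope_def_field, norm_div]
      calc ‖f z - f w‖ / ‖z - w‖ ≤ ‖f z - f w‖ / ρ := by gcongr
        _ = ρ⁻¹ * ‖f z - f w‖ := by rw [div_eq_inv_mul]
        _ ≤ ρ⁻¹ * (‖f z‖ + ‖f w‖) := by gcongr; exact norm_sub_le _ _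
        _ ≤ _ := by nlinarith [abs_nonneg A]
  refine ⟨ofMemLp _ hd hL, fun z hz => ?_⟩
  have h := sub_smul_dslope (f : ℂ → ℂ) w z
  rw [smul_eq_mul] at h
  rw [ofMemLp_apply hd hL hz, ← sub_mul, h]
  ring

theorem mulZ_pow_apply [Fact (1 ≤ p)] [Fact (-1 < α)] (f : Bergman p α) (n : ℕ) (z : ℂ) :
    (mulZ p α ^ n) f z = z ^ n * f z := by
  induction n with
  | zero => simp
  | succ n ih =>
    have h : (mulZ p α ^ (n + 1)) f = mulZ p α ((mulZ p α ^ n) f) := by rw [pow_succ']; rfl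
    rw [h, mulZ_apply, ih]
    ring

/-- The powers of `M_z` tend strongly to zero. -/
theorem tendsto_norm_mulZ_pow [hp1 : Fact (1 ≤ p)] (hp : p ≠ ∞) [Fact (-1 < α)]
    (f : Bergman p α) :
    Filter.Tendsto (fun n : ℕ => ‖(mulZ p α ^ n) f‖) Filter.atTop (nhds 0) := by
  have h0 : p ≠ 0 := (zero_lt_one.trans_le hp1.out).ne'
  have hq : 0 < p.toReal := ENNReal.toReal_pos h0 hp
  have hlim : Filter.Tendsto (fun n : ℕ => ∫⁻ z, ‖(mulZ p α ^ n) f z‖ₑ ^ p.toReal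
      ∂(weightedArea α)) Filter.atTop (nhds (∫⁻ _, 0 ∂(weightedArea α))) := by
    -- Since `|z| < 1`, the functions `z ^ n * f z` tend to zero pointwise and are dominated by `f`.
    refine tendsto_lintegral_of_dominated_convergence' (fun z => ‖f z‖ₑ ^ p.toReal)
      (fun n => ((isAnalyticOnDisk _).aestronglyMeasurable α).enorm.pow_const _)
      (fun n => ?_) ?_ ?_
    · filter_upwards [ae_weightedArea α] with z hz
      refine ENNReal.rpow_le_rpow ?_ hq.le
      rw [mulZ_pow_apply, enorm_le_iff_norm_le, norm_mul, norm_pow]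
      exact mul_le_of_le_one_left (norm_nonneg _)
        (pow_le_one₀ (norm_nonneg _) (mem_unitDisk.1 hz).le)
    · exact (lintegral_rpow_enorm_lt_top_of_eLpNorm_lt_top h0 hp f.memLp.eLpNorm_lt_top).ne
    · filter_upwards [ae_weightedArea α] with z hz
      have h1 : Filter.Tendsto (fun n : ℕ => z ^ n * f z) Filter.atTop (nhds (0 * f z)) :=
        (tendsto_pow_atTop_nhds_zero_of_norm_lt_one (mem_unitDisk.1 hz)).mul_const _
      have h2 := (ENNReal.continuous_rpow_const (y := p.toReal)).continuousAt.tendsto.comp h1.enorm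
      simp only [zero_mul, enorm_zero, ENNReal.zero_rpow_of_pos hq] at h2
      simpa only [mulZ_pow_apply, Function.comp_def] using h2
  have h3 := (ENNReal.continuous_rpow_const (y := 1 / p.toReal)).continuousAt.tendsto.comp hlim
  have hq' : 0 < 1 / p.toReal := by positivity
  simp only [lintegral_zero, ENNReal.zero_rpow_of_pos hq'] at h3
  have h4 := (ENNReal.tendsto_toReal ENNReal.zero_ne_top).comp h3
  refine h4.congr fun n => ?_
  rw [norm_def, eLpNorm_eq_lintegral_rpow_enorm_toReal h0 hp]
  rfl

/-- The commutant of `M_z` consists of multiplication operators. -/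
theorem commutant_apply [Fact (1 ≤ p)] [hα : Fact (-1 < α)] {B : Bergman p α →L[ℂ] Bergman p α}
    (hB : B ∈ commutantAlgebra (mulZ p α)) (f : Bergman p α) {w : ℂ} (hw : w ∈ unitDisk) :
    B f w = B (one p α) w * f w := by
  obtain ⟨g, hg⟩ := exists_eq_smul_one_add hα.out f hw
  -- `B` commutes with `M_z - w`, so the image of the last summand vanishes at `w`.
  have hf : f = f w • one p α + (mulZ p α g - w • g) := ext fun z hz => by
    rw [add_apply, sub_apply, smul_apply, smul_apply, mulZ_apply, one_apply hz, mul_one]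
    exact hg z hz
  have hBz : B (mulZ p α g) = mulZ p α (B g) := (DFunLike.congr_fun hB g).symm
  have h := congrArg (fun h : Bergman p α => h w) (congrArg B hf)
  simp only [map_add, map_sub, map_smul, hBz, add_apply, sub_apply, smul_apply, mulZ_apply] at h
  rw [h]
  ring

/-! ### Abelian intertwiners of `M_z` -/

section Intertwiner

variable [Fact (1 ≤ p)] [hα : Fact (-1 < α)] {T B : Bergman p α →L[ℂ] Bergman p α}

/-- Since `B` is multiplication by `b = B1`, the functional `f ↦ (T f)(w)`, if nonzero, is an
eigenvector of the transpose of `M_z` with eigenvalue `b(w)`. -/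
theorem intertwiner_mulZ_apply (hB : B ∈ commutantAlgebra (mulZ p α))
    (hT : T ∘L mulZ p α = B ∘L T) (f : Bergman p α) {w : ℂ} (hw : w ∈ unitDisk) :
    T (mulZ p α f) w = B (one p α) w * T f w := by
  rw [← commutant_apply hB (T f) hw]
  exact congrArg (fun h : Bergman p α => h w) (DFunLike.congr_fun hT f)

/-- Such a functional kills the range of `M_z - b(w)`, which contains `f - f(b(w))`; so it is a
multiple of evaluation at `b(w)`. -/
theorem intertwiner_apply (hB : B ∈ commutantAlgebra (mulZ p α))
    (hT : T ∘L mulZ p α = B ∘L T) (f : Bergman p α) {w : ℂ} (hw : w ∈ unitDisk)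
    (hφ : B (one p α) w ∈ unitDisk) : T f w = T (one p α) w * f (B (one p α) w) := by
  set v := B (one p α) w with hv
  obtain ⟨g, hg⟩ := exists_eq_smul_one_add hα.out f hφ
  have hf : f = f v • one p α + (mulZ p α g - v • g) := ext fun z hz => by
    rw [add_apply, sub_apply, smul_apply, smul_apply, mulZ_apply, one_apply hz, mul_one]
    exact hg z hz
  have h := congrArg (fun h : Bergman p α => h w) (congrArg T hf)
  simp only [map_add, map_sub, map_smul, add_apply, sub_apply, smul_apply,
    intertwiner_mulZ_apply hB hT g hw] at h
  rw [h]
  ring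

/-- Replacing `f` by `z ^ n f` multiplies the value at `w` by `b(w) ^ n`, which does not shrink it,
whereas `z ^ n f` tends to zero in norm. -/
theorem intertwiner_apply_eq_zero (hp : p ≠ ∞) (hB : B ∈ commutantAlgebra (mulZ p α))
    (hT : T ∘L mulZ p α = B ∘L T) (f : Bergman p α) {w : ℂ} (hw : w ∈ unitDisk)
    (hφ : 1 ≤ ‖B (one p α) w‖) : T f w = 0 := by
  have hpow : ∀ n : ℕ, T ((mulZ p α ^ n) f) w = B (one p α) w ^ n * T f w := fun n => by
    induction n with
    | zero => simp
    | succ n ih =>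
      have h : (mulZ p α ^ (n + 1)) f = mulZ p α ((mulZ p α ^ n) f) := by rw [pow_succ']; rfl
      rw [h, intertwiner_mulZ_apply hB hT _ hw, ih]
      ring
  obtain ⟨C, hC⟩ := exists_norm_apply_le (p := p) (α := α) hp hw
  have hC' : ∀ g : Bergman p α, ‖g w‖ ≤ |C| * ‖g‖ := fun g =>
    (hC g).trans (mul_le_mul_of_nonneg_right (le_abs_self C) (norm_nonneg g))
  have hle : ∀ n : ℕ, ‖T f w‖ ≤ |C| * (‖T‖ * ‖(mulZ p α ^ n) f‖) := fun n => by
    refine le_trans ?_ ((hC' (T ((mulZ p α ^ n) f))).trans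
      (mul_le_mul_of_nonneg_left (T.le_opNorm _) (abs_nonneg C)))
    rw [hpow, norm_mul, norm_pow]
    exact le_mul_of_one_le_left (norm_nonneg _) (one_le_pow₀ hφ)
  have hlim := ((tendsto_norm_mulZ_pow hp f).const_mul ‖T‖).const_mul |C|
  rw [mul_zero, mul_zero] at hlim
  exact norm_le_zero_iff.1 (ge_of_tendsto' hlim hle)

theorem intertwiner_eq_zero (hp : p ≠ ∞) (hB : B ∈ commutantAlgebra (mulZ p α))
    (hT : T ∘L mulZ p α = B ∘L T) {w : ℂ} (hw : w ∈ unitDisk)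
    (hφ : 1 ≤ ‖B (one p α) w‖) (f : Bergman p α) {z : ℂ} (hz : z ∈ unitDisk) : T f z = 0 := by
  have hD : ∀ᶠ z in nhds w, z ∈ unitDisk := Metric.isOpen_ball.mem_nhds hw
  -- Otherwise `|b| < 1` on a punctured neighbourhood of `w`, so `|b|` has a local maximum at `w`
  -- and `b` is locally constant there, with modulus at least `1`: a contradiction. The identity
  -- theorem needs this accumulation of zeros.
  have hfreq : ∃ᶠ z in nhdsWithin w {w}ᶜ, 1 ≤ ‖B (one p α) z‖ := by
    intro hlt
    have hmax : IsLocalMax (norm ∘ (B (one p α) : ℂ → ℂ)) w := by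
      filter_upwards [eventually_nhdsWithin_iff.1 hlt] with z hz
      by_cases hzw : z = w
      · rw [hzw]
      · exact (not_le.1 (hz hzw)).le.trans hφ
    have hc := Complex.eventually_eq_of_isLocalMax_norm (hD.mono fun z hz =>
      (B (one p α)).isAnalyticOnDisk.differentiableAt (Metric.isOpen_ball.mem_nhds hz)) hmax
    obtain ⟨z, hz1, hz2⟩ := (hlt.and (hc.filter_mono nhdsWithin_le_nhds)).exists
    exact hz1 (hφ.trans_eq (congrArg norm hz2.symm))
  have hzero : ∃ᶠ z in nhdsWithin w {w}ᶜ, T f z = 0 :=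
    (hfreq.and_eventually (hD.filter_mono nhdsWithin_le_nhds)).mono fun z hz =>
      intertwiner_apply_eq_zero hp hB hT f hz.2 hz.1
  exact (DifferentiableOn.analyticOnNhd (T f).isAnalyticOnDisk
    Metric.isOpen_ball).eqOn_zero_of_preconnected_of_frequently_eq_zero
    (convex_ball (0 : ℂ) 1).isPreconnected hw hzero hz

end Intertwiner

end Bergman

/-! ### The characterization -/

theorem IsAnalyticSelfMap.isHInfty {φ : ℂ → ℂ} (hφ : IsAnalyticSelfMap φ) : IsHInfty φ :=
  ⟨hφ.1, 1, fun _ hz => (mem_unitDisk.1 (hφ.2 hz)).le⟩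

theorem proposition4p2 (p : ℝ≥0∞) [Fact (1 ≤ p)] (hp : p ≠ ∞) (α : ℝ) [Fact (-1 < α)] :
    (∀ m φ : ℂ → ℂ, IsHInfty m → IsAnalyticSelfMap φ →
      ∃ T : Bergman p α →L[ℂ] Bergman p α,
        Bergman.IsWeightedComposition T m φ ∧ IsAbelianIntertwiner (Bergman.mulZ p α) T) ∧
    (∀ T : Bergman p α →L[ℂ] Bergman p α,
      IsAbelianIntertwiner (Bergman.mulZ p α) T → IsHInfty (T (Bergman.one p α)) →
      ∃ m φ : ℂ → ℂ, IsHInfty m ∧ IsAnalyticSelfMap φ ∧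
        Bergman.IsWeightedComposition T m φ) := by
  refine ⟨fun m φ hm hφ => ?_, fun T ⟨B, hB, hTB⟩ hm => ?_⟩
  · obtain ⟨T, hT⟩ := Bergman.exists_isWeightedComposition (p := p) (α := α) hp hm hφ
    -- `B = M_φ`, obtained as the weighted composition operator with weight `φ` and the identity as
    -- self-map.
    obtain ⟨B, hB⟩ := Bergman.exists_isWeightedComposition (p := p) (α := α) hp
      (φ := fun z => z) hφ.isHInfty ⟨differentiableOn_id, fun _ hz => hz⟩
    refine ⟨T, hT, B, ?_, ?_⟩
    · refine ContinuousLinearMap.ext fun f => Bergman.ext fun z hz => ?_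
      simp only [ContinuousLinearMap.comp_apply]
      rw [hB _ z hz, Bergman.mulZ_apply, Bergman.mulZ_apply, hB _ z hz]
      ring
    · refine ContinuousLinearMap.ext fun f => Bergman.ext fun z hz => ?_
      simp only [ContinuousLinearMap.comp_apply]
      rw [hB _ z hz, hT _ z hz, hT _ z hz, Bergman.mulZ_apply]
      ring
  · by_cases h : Set.MapsTo (B (Bergman.one p α) : ℂ → ℂ) unitDisk unitDisk
    · exact ⟨_, _, hm, ⟨Bergman.isAnalyticOnDisk _, h⟩,
        fun f z hz => Bergman.intertwiner_apply hB hTB f hz (h hz)⟩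
    · simp only [Set.MapsTo, not_forall] at h
      obtain ⟨w, hw, hφw⟩ := h
      rw [mem_unitDisk, not_lt] at hφw
      -- Here `T = 0`, so the weight is zero and any self-map would do.
      refine ⟨fun _ => 0, fun _ => 0, ⟨differentiableOn_const _, 0, by simp⟩,
        ⟨differentiableOn_const _, fun _ _ => mem_unitDisk.2 (by simp)⟩, fun f z hz => ?_⟩
      rw [zero_mul]
      exact Bergman.intertwiner_eq_zero hp hB hTB hw hφw f hz
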